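/- All subshifts are two-sided and over finite alphabets: a subshift is a closed shift-invariant subset of a full shift $\mathcal A^{\mathbb Z}$. A code is a continuous shift-commuting map between subshifts; it is right closing (resp. left closing) if it never identifies two distinct points that agree on some $(-\infty,N]$ (resp. on some $[N,\infty)$), and bi-closing if it is both. A shift of finite type (SFT) is a subshift conjugate to the edge shift of a finite directed graph. A subshift is irreducible if it has a point with dense forward orbit, and indecomposable if it is not the union of two disjoint nonempty subshifts. Write $h$ for topological entropy. **Theorem 4.3.** Let $X$ be a subshift, $Y$ an irreducible SFT with $h(X)<h(Y)$, and $\phi:X\to Y$ a bi-closing code. Then the maximum $d=\max\{|\phi^{-1}(y)| : y\in Y\}$ exists and is finite, and the following hold. For $n\in\mathbb N$, let $(\ast)_n$ be the statement: there exist an irreducible SFT $\tilde X\supset X$ (over a finite alphabet containing that of $X$) and an onto code $\tilde\phi:\tilde X\to Y$ with $\tilde\phi|_X=\phi$ such that every point of $Y$ has exactly $n$ preimages under $\tilde\phi$. 1. If $X$ is a nonempty indecomposable SFT, then $(\ast)_n$ holds for all $n\ge d$. 2. If $X$ is an SFT, then $(\ast)_n$ holds for all $n\ge d+1$. 3. For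 an arbitrary subshift $X$, there is an $m\ge d$ such that $(\ast)_n$ holds for all $n\ge m$. -/

import Mathlib

open SymbolicDynamics.FullShift

namespace BiclosingExtension

universe u v

section Subshifts

variable {A : Type u} [TopologicalSpace A] {C : Type v} [TopologicalSpace C]

/-- The shift map `σ` of a two-sided subshift: `(σ x) i = x (1 + i)`. -/
def shiftMap (X : Subshift A ℤ) : X.carrier → X.carrier :=
  (X.mapsTo 1).restrict

/-- The topological entropy `h(X)` of the shift map on `X`. The uniform structure on the
sequence space is the product of the discrete ones, which on a finite alphabet is the one
compatible with the product topology. -/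
noncomputable def entropy (X : Subshift A ℤ) : EReal :=
  letI : UniformSpace A := ⊥
  Dynamics.coverEntropy (shift (1 : ℤ)) X.carrier

/-- A subshift is indecomposable if it is not the union of two disjoint nonempty subshifts. -/
def IsIndecomposable (X : Subshift A ℤ) : Prop :=
  ¬ ∃ X₁ X₂ : Subshift A ℤ, X₁.carrier.Nonempty ∧ X₂.carrier.Nonempty ∧
    Disjoint X₁.carrier X₂.carrier ∧ X.carrier = X₁.carrier ∪ X₂.carrier

/-- A subshift is irreducible if some point of it has a dense forward orbit. -/
def IsIrreducible (X : Subshift A ℤ) : Prop :=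
  ∃ x : X.carrier, Dense (Set.range fun k : ℕ => (shiftMap X)^[k] x)

/-- A code is a continuous shift-commuting map between subshifts. -/
structure IsCode {X : Subshift A ℤ} {Y : Subshift C ℤ} (φ : X.carrier → Y.carrier) : Prop where
  continuous : Continuous φ
  comm : ∀ x, φ (shiftMap X x) = shiftMap Y (φ x)

/-- A conjugacy is a bijective code (its inverse is then a code as well, by compactness). -/
def IsConjugate (X : Subshift A ℤ) (Y : Subshift C ℤ) : Prop :=
  ∃ φ : X.carrier → Y.carrier, IsCode φ ∧ Function.Bijective φ

/-- Two bi-infinite sequences are left asymptotic if they agree on some `(-∞, N]`. -/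
def LeftAsymptotic (x x' : ℤ → A) : Prop := ∃ N : ℤ, ∀ i ≤ N, x i = x' i

/-- Two bi-infinite sequences are right asymptotic if they agree on some `[N, ∞)`. -/
def RightAsymptotic (x x' : ℤ → A) : Prop := ∃ N : ℤ, ∀ i ≥ N, x i = x' i

/-- Right closing: no two distinct left asymptotic points are collapsed. -/
def IsRightClosing {X : Subshift A ℤ} {Y : Subshift C ℤ} (φ : X.carrier → Y.carrier) : Prop :=
  ∀ x x' : X.carrier, LeftAsymptotic x.1 x'.1 → φ x = φ x' → x = x'

/-- Left closing: no two distinct right asymptotic points are collapsed. -/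
def IsLeftClosing {X : Subshift A ℤ} {Y : Subshift C ℤ} (φ : X.carrier → Y.carrier) : Prop :=
  ∀ x x' : X.carrier, RightAsymptotic x.1 x'.1 → φ x = φ x' → x = x'

/-- Bi-closing: left and right closing. -/
def IsBiclosing {X : Subshift A ℤ} {Y : Subshift C ℤ} (φ : X.carrier → Y.carrier) : Prop :=
  IsLeftClosing φ ∧ IsRightClosing φ

end Subshifts

/-- A finite directed graph; loops and multiple edges are allowed. -/
structure FinGraph where
  V : Type
  E : Type
  finiteV : Finite V
  finiteE : Finite E
  src : E → V
  tgt : E → V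

instance (G : FinGraph) : TopologicalSpace G.E := ⊥

instance (G : FinGraph) : DiscreteTopology G.E := ⟨rfl⟩

/-- The edge shift of a graph: the set of all bi-infinite trips on the graph. -/
def edgeShift (G : FinGraph) : Subshift G.E ℤ where
  carrier := {x | ∀ i : ℤ, G.tgt (x i) = G.src (x (i + 1))}
  isClosed := by
    have h : {x : ℤ → G.E | ∀ i : ℤ, G.tgt (x i) = G.src (x (i + 1))} =
        ⋂ i : ℤ, (fun x : ℤ → G.E => (x i, x (i + 1))) ⁻¹' {p | G.tgt p.1 = G.src p.2} := by
      ext x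
      simp
    rw [h]
    exact isClosed_iInter fun i => (isClosed_discrete _).preimage (by fun_prop)
  mapsTo := fun g x hx i => by
    simpa [add_assoc] using hx (g + i)

/-- A shift of finite type is a subshift that is conjugate to an edge shift. -/
def IsSFT {A : Type u} [TopologicalSpace A] (X : Subshift A ℤ) : Prop :=
  ∃ G : FinGraph, IsConjugate X (edgeShift G)

/-- There are an irreducible shift of finite type `X' ⊇ X`, over a finite alphabet `B` that contains
`A` (through the embedding `ι` of letters), and an onto code `φ' : X' → Y` which extends `φ` and is
`n`-to-1, that is, every point of `Y` has exactly `n` preimages. -/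
def HasIrreducibleExtension {A : Type u} [TopologicalSpace A] {C : Type v} [TopologicalSpace C]
    {X : Subshift A ℤ} {Y : Subshift C ℤ} (φ : X.carrier → Y.carrier) (n : ℕ) : Prop :=
  ∃ (B : Type u) (_ : Finite B) (_ : TopologicalSpace B) (_ : DiscreteTopology B) (ι : A ↪ B)
    (X' : Subshift B ℤ) (hX : ∀ x ∈ X.carrier, ι ∘ x ∈ X'.carrier)
    (φ' : X'.carrier → Y.carrier),
    IsSFT X' ∧ IsIrreducible X' ∧ IsCode φ' ∧
      (∀ x : X.carrier, φ' ⟨ι ∘ x.1, hX x.1 x.2⟩ = φ x) ∧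
      Function.Surjective φ' ∧ ∀ y : Y.carrier, (φ' ⁻¹' {y}).encard = n

end BiclosingExtension

/-! Bi-closing makes `φ` uniformly injective on fibres: points with the same image that agree on one
fixed window are equal. By compactness the points of `X` then carry a continuous label in `{0, …, d
- 1}` that is injective on every fibre (`IsBiclosing.exists_label`).

The extension is a skew product over `Y`. Present `Y` as the edge shift of a strongly connected
graph `H` whose edges are such long blocks that, over each edge, the transitions from the label of
`x` to the label of its shift form a partial injection. Completing these to permutations of `n ≥ d`
labels gives a covering graph of `H`. Its edge shift projects exactly `n`-to-one onto that of `H`,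
and `X` embeds in it through image and label.

Irreducibility is where entropy enters: `h(X) < h(Y)` forces `φ` to miss a point, hence some edge
`e₀` carries no constraint. Reachability in a finite cover of `H` is symmetric, and interchanging
the targets of two lifts of `e₀` in different components merges these components. A completion with
the most reachable pairs is therefore strongly connected (`exists_skewProduct_connected`). Finally
`exists_recoding` turns the embedding of `X` into an inclusion of letters.

All three clauses come from the single case `n ≥ d`, `n > 0`; positivity keeps the cover nonempty.
-/

namespace BiclosingExtension

universe u v

/-! ### Codes, translations and uniform windows from compactness -/

section Basics

variable {A : Type u} [TopologicalSpace A] {C : Type v} [TopologicalSpace C]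

/-- Translation of the points of a subshift by an arbitrary integer. -/
def translate (X : Subshift A ℤ) (t : ℤ) : X.carrier → X.carrier :=
  (X.mapsTo t).restrict

@[simp] lemma translate_apply (X : Subshift A ℤ) (t : ℤ) (x : X.carrier) (i : ℤ) :
    (translate X t x).1 i = x.1 (t + i) := rfl

lemma shiftMap_eq_translate (X : Subshift A ℤ) : shiftMap X = translate X 1 := rfl

@[simp] lemma shiftMap_apply (X : Subshift A ℤ) (x : X.carrier) (i : ℤ) :
    (shiftMap X x).1 i = x.1 (1 + i) := rfl

lemma translate_translate (X : Subshift A ℤ) (s t : ℤ) (x : X.carrier) :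
    translate X s (translate X t x) = translate X (t + s) x := by
  ext i
  simp [add_assoc]

lemma translate_zero (X : Subshift A ℤ) (x : X.carrier) : translate X 0 x = x := by
  ext i
  simp

lemma iterate_shiftMap (X : Subshift A ℤ) (k : ℕ) (x : X.carrier) :
    (shiftMap X)^[k] x = translate X k x := by
  induction k with
  | zero => simp [translate_zero]
  | succ k ih =>
    rw [Function.iterate_succ_apply', ih, shiftMap_eq_translate, translate_translate]
    push_cast
    rfl

lemma continuous_translate (X : Subshift A ℤ) (t : ℤ) : Continuous (translate X t) :=
  (continuous_shift t).restrict (X.mapsTo t)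

lemma continuous_coord (X : Subshift A ℤ) (i : ℤ) : Continuous fun x : X.carrier => x.1 i :=
  (continuous_apply i).comp continuous_subtype_val

instance [Finite A] (X : Subshift A ℤ) : CompactSpace X.carrier :=
  isCompact_iff_compactSpace.mp X.isClosed.isCompact

lemma IsCode.map_translate {X : Subshift A ℤ} {Y : Subshift C ℤ} {φ : X.carrier → Y.carrier}
    (hφ : IsCode φ) (t : ℤ) (x : X.carrier) : φ (translate X t x) = translate Y t (φ x) := by
  have key : ∀ (k : ℕ) (x : X.carrier), φ (translate X k x) = translate Y k (φ x) := by
    intro k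
    induction k with
    | zero => simp [translate_zero]
    | succ k ih =>
      intro x
      have h := hφ.comm (translate X k x)
      rw [shiftMap_eq_translate, shiftMap_eq_translate, ih, translate_translate,
        translate_translate] at h
      exact_mod_cast h
  obtain ⟨k, rfl | rfl⟩ := t.eq_nat_or_neg
  · exact key k x
  · have h := key k (translate X (-k) x)
    rw [translate_translate, neg_add_cancel, translate_zero] at h
    rw [h, translate_translate, add_neg_cancel, translate_zero]

lemma IsCode.comp {D : Type*} [TopologicalSpace D] {X : Subshift A ℤ} {Y : Subshift C ℤ}
    {Z : Subshift D ℤ} {ψ : Y.carrier → Z.carrier} {φ : X.carrier → Y.carrier}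
    (hψ : IsCode ψ) (hφ : IsCode φ) : IsCode (ψ ∘ φ) :=
  ⟨hψ.continuous.comp hφ.continuous, fun x => by simp [hφ.comm, hψ.comm]⟩

/-- A bijective code has a code as its inverse. -/
lemma IsCode.exists_inverse [Finite A] [T2Space C] {X : Subshift A ℤ}
    {Y : Subshift C ℤ} {φ : X.carrier → Y.carrier} (hφ : IsCode φ)
    (hb : Function.Bijective φ) :
    ∃ ψ : Y.carrier → X.carrier, IsCode ψ ∧ Function.LeftInverse ψ φ ∧
      Function.RightInverse ψ φ := by
  let e := Equiv.ofBijective φ hb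
  have hc : Continuous e := hφ.continuous
  refine ⟨e.symm, ⟨hc.continuous_symm_of_equiv_compact_to_t2, fun y => ?_⟩,
    e.symm_apply_apply, e.apply_symm_apply⟩
  apply e.injective
  rw [e.apply_symm_apply]
  have h := hφ.comm (e.symm y)
  change e _ = shiftMap Y (e (e.symm y)) at h
  rw [h, e.apply_symm_apply]

/-- Irreducibility passes to factors. -/
lemma IsIrreducible.of_surjective {X : Subshift A ℤ} {Y : Subshift C ℤ}
    {φ : X.carrier → Y.carrier} (hX : IsIrreducible X) (hφ : IsCode φ)
    (hs : Function.Surjective φ) : IsIrreducible Y := by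
  obtain ⟨x, hx⟩ := hX
  refine ⟨φ x, ?_⟩
  have h : DenseRange (φ ∘ fun k : ℕ => (shiftMap X)^[k] x) :=
    hs.denseRange.comp hx hφ.continuous
  have he : (fun k : ℕ => (shiftMap Y)^[k] (φ x)) = φ ∘ fun k : ℕ => (shiftMap X)^[k] x := by
    funext k
    simp only [iterate_shiftMap, Function.comp, hφ.map_translate]
  rw [he]
  exact h

/-- Two sequences agree on the window `[-r, r]`. -/
def AgreeOn {A : Type*} (r : ℕ) (x y : ℤ → A) : Prop := ∀ j : ℤ, |j| ≤ r → x j = y j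

lemma AgreeOn.mono {A : Type*} {r s : ℕ} (h : r ≤ s) {x y : ℤ → A} (hxy : AgreeOn s x y) :
    AgreeOn r x y :=
  fun j hj => hxy j (hj.trans (by exact_mod_cast h))

lemma isClosed_agreeOn [T2Space A] {T : Type*} [TopologicalSpace T] {f g : T → ℤ → A}
    (hf : Continuous f) (hg : Continuous g) (r : ℕ) :
    IsClosed {t | AgreeOn r (f t) (g t)} := by
  simp only [AgreeOn, Set.ofPred_forall]
  exact isClosed_iInter fun j => isClosed_iInter fun _ =>
    isClosed_eq ((continuous_apply j).comp hf) ((continuous_apply j).comp hg)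

/-- Cantor's intersection theorem, contraposed. The uniform windows and bounds below come from it.
-/
lemma exists_forall_notMem_of_antitone {T : Type*} [TopologicalSpace T] [CompactSpace T]
    {F : ℕ → Set T} (hF : Antitone F) (hc : ∀ r, IsClosed (F r)) (h : ∀ t, ∃ r, t ∉ F r) :
    ∃ r, ∀ t, t ∉ F r := by
  by_contra! hne
  obtain ⟨t, ht⟩ := IsCompact.nonempty_iInter_of_sequence_nonempty_isCompact_isClosed F
    (fun i => hF i.le_succ) hne (hc 0).isCompact hc
  obtain ⟨r, hr⟩ := h t
  exact hr (Set.mem_iInter.mp ht r)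

/-- Compactness: points of a closed set on which `f ≠ g` are told apart by a common window. -/
lemma exists_window [T2Space A] {T : Type*} [TopologicalSpace T] [CompactSpace T]
    {f g : T → ℤ → A} (hf : Continuous f) (hg : Continuous g) {S : Set T} (hS : IsClosed S)
    (h : ∀ t ∈ S, f t ≠ g t) : ∃ r : ℕ, ∀ t ∈ S, ¬ AgreeOn r (f t) (g t) := by
  obtain ⟨r, hr⟩ := exists_forall_notMem_of_antitone
    (F := fun r => S ∩ {t | AgreeOn r (f t) (g t)})
    (fun r s hrs t ht => ⟨ht.1, AgreeOn.mono hrs ht.2⟩)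
    (fun r => hS.inter (isClosed_agreeOn hf hg r)) (fun t => by
      by_contra! hall
      exact h t (hall 0).1 (funext fun j => (hall j.natAbs).2 j (by simp)))
  exact ⟨r, fun t ht h' => hr t ⟨ht, h'⟩⟩

/-- A continuous function to a discrete space that factors through a continuous map `φ`
depends only on a window of `φ`. -/
lemma exists_window_of_factors [Finite A] [T2Space C] {X : Subshift A ℤ} {Y : Subshift C ℤ}
    {φ : X.carrier → Y.carrier} (hφ : Continuous φ) {D : Type*} [TopologicalSpace D]
    [DiscreteTopology D] {g : X.carrier → D} (hg : Continuous g)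
    (h : ∀ x x', φ x = φ x' → g x = g x') :
    ∃ r : ℕ, ∀ x x', AgreeOn r (φ x).1 (φ x').1 → g x = g x' := by
  obtain ⟨r, hr⟩ := exists_window (T := X.carrier × X.carrier)
    (f := fun p => (φ p.1).1) (g := fun p => (φ p.2).1) (by fun_prop) (by fun_prop)
    (S := {p | g p.1 ≠ g p.2})
    ((isClosed_discrete {q : D × D | q.1 ≠ q.2}).preimage
      (f := fun p : X.carrier × X.carrier => (g p.1, g p.2)) (by fun_prop))
    (fun p hp he => hp (h _ _ (Subtype.ext he)))
  exact ⟨r, fun x x' hx => by_contra fun hne => hr (x, x') hne hx⟩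

/-- The central block of radius `r` of a sequence. -/
def block {A : Type*} (r : ℕ) (x : ℤ → A) : Set.Icc (-r : ℤ) r → A := fun j => x j

lemma block_eq_iff {A : Type*} {r : ℕ} {x y : ℤ → A} : block r x = block r y ↔ AgreeOn r x y := by
  simp only [block, funext_iff, AgreeOn, Subtype.forall, Set.mem_Icc, abs_le]

lemma continuous_block (r : ℕ) : Continuous (block r : (ℤ → C) → _) :=
  continuous_pi fun _ => continuous_apply _

lemma isClosed_coord_eq [T2Space A] {X : Subshift A ℤ} (j : ℤ) :
    IsClosed {p : X.carrier × X.carrier | p.1.1 j = p.2.1 j} :=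
  isClosed_eq ((continuous_coord X j).comp continuous_fst)
    ((continuous_coord X j).comp continuous_snd)

lemma isClosed_coord_ne [DiscreteTopology A] {X : Subshift A ℤ} (j : ℤ) :
    IsClosed {p : X.carrier × X.carrier | p.1.1 j ≠ p.2.1 j} :=
  (isClosed_discrete {q : A × A | q.1 ≠ q.2}).preimage
    (((continuous_coord X j).comp continuous_fst).prodMk
      ((continuous_coord X j).comp continuous_snd))

end Basics

/-! ### Fibres of bi-closing codes and their labelling -/

section Closing

variable {A : Type u} [TopologicalSpace A] [DiscreteTopology A] [Finite A]
  {C : Type v} [TopologicalSpace C] [DiscreteTopology C]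
  {X : Subshift A ℤ} {Y : Subshift C ℤ} {φ : X.carrier → Y.carrier}

/-- If no `N` worked, compactness would yield two points with the same image that agree on `(-∞, 0]`
and differ at `1`. -/
lemma IsRightClosing.exists_bound (hφ : IsCode φ) (h : IsRightClosing φ) :
    ∃ N : ℕ, ∀ x x' : X.carrier, φ x = φ x' → (∀ j : ℤ, -N ≤ j → j ≤ 0 → x.1 j = x'.1 j) →
      ∀ j : ℤ, 0 ≤ j → x.1 j = x'.1 j := by
  obtain ⟨N, hN⟩ := exists_forall_notMem_of_antitone (T := X.carrier × X.carrier)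
    (F := fun N => {p | φ p.1 = φ p.2} ∩
      ((⋂ j : ℤ, ⋂ _ : -(N : ℤ) ≤ j ∧ j ≤ 0, {p | p.1.1 j = p.2.1 j}) ∩
      {p | p.1.1 1 ≠ p.2.1 1}))
    (fun r s hrs p hp => by
      simp only [Set.mem_inter_iff, Set.mem_iInter, Set.mem_ofPred_eq] at hp ⊢
      exact ⟨hp.1, fun j hj => hp.2.1 j ⟨by omega, hj.2⟩, hp.2.2⟩)
    (fun r => (isClosed_eq (hφ.continuous.comp continuous_fst)
      (hφ.continuous.comp continuous_snd)).inter
        ((isClosed_iInter fun j => isClosed_iInter fun _ => isClosed_coord_eq j).inter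
          (isClosed_coord_ne 1)))
    (fun p => by
      by_contra! hall
      simp only [Set.mem_inter_iff, Set.mem_iInter, Set.mem_ofPred_eq] at hall
      apply (hall 0).2.2
      rw [h p.1 p.2 ⟨0, fun i hi => (hall i.natAbs).2.1 i ⟨by omega, hi⟩⟩ (hall 0).1])
  refine ⟨N, fun x x' he hx => ?_⟩
  -- Agreement spreads one coordinate at a time: with the window slid to end at `m`, `hN` forces
  -- coordinate `m + 1`.
  have key : ∀ m : ℕ, ∀ j : ℤ, -N ≤ j → j ≤ m → x.1 j = x'.1 j := by
    intro m
    induction m with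
    | zero => simpa using hx
    | succ m ih =>
      intro j hj hjm
      rcases (show j ≤ m ∨ j = m + 1 by push_cast at hjm; omega) with hj' | rfl
      · exact ih j hj hj'
      · by_contra hne
        refine hN (translate X m x, translate X m x') ⟨?_, ?_, ?_⟩
        · simp [hφ.map_translate, he]
        · simp only [Set.mem_iInter, Set.mem_ofPred_eq, translate_apply]
          exact fun j hj => ih _ (by omega) (by omega)
        · simpa using hne
  exact fun j hj => key j.natAbs j (by omega) (by omega)

lemma IsLeftClosing.exists_bound (hφ : IsCode φ) (h : IsLeftClosing φ) :
    ∃ N : ℕ, ∀ x x' : X.carrier, φ x = φ x' → (∀ j : ℤ, 0 ≤ j → j ≤ N → x.1 j = x'.1 j) →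
      ∀ j : ℤ, j ≤ 0 → x.1 j = x'.1 j := by
  obtain ⟨N, hN⟩ := exists_forall_notMem_of_antitone (T := X.carrier × X.carrier)
    (F := fun N => {p | φ p.1 = φ p.2} ∩
      ((⋂ j : ℤ, ⋂ _ : 0 ≤ j ∧ j ≤ N, {p | p.1.1 j = p.2.1 j}) ∩
      {p | p.1.1 (-1) ≠ p.2.1 (-1)}))
    (fun r s hrs p hp => by
      simp only [Set.mem_inter_iff, Set.mem_iInter, Set.mem_ofPred_eq] at hp ⊢
      exact ⟨hp.1, fun j hj => hp.2.1 j ⟨hj.1, by omega⟩, hp.2.2⟩)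
    (fun r => (isClosed_eq (hφ.continuous.comp continuous_fst)
      (hφ.continuous.comp continuous_snd)).inter
        ((isClosed_iInter fun j => isClosed_iInter fun _ => isClosed_coord_eq j).inter
          (isClosed_coord_ne (-1))))
    (fun p => by
      by_contra! hall
      simp only [Set.mem_inter_iff, Set.mem_iInter, Set.mem_ofPred_eq] at hall
      apply (hall 0).2.2
      rw [h p.1 p.2 ⟨0, fun i hi => (hall i.natAbs).2.1 i ⟨hi, by omega⟩⟩ (hall 0).1])
  refine ⟨N, fun x x' he hx => ?_⟩
  have key : ∀ m : ℕ, ∀ j : ℤ, -m ≤ j → j ≤ N → x.1 j = x'.1 j := by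
    intro m
    induction m with
    | zero => simpa using hx
    | succ m ih =>
      intro j hjm hj
      rcases (show -m ≤ j ∨ j = -m + -1 by push_cast at hjm; omega) with hj' | rfl
      · exact ih j hj' hj
      · by_contra hne
        refine hN (translate X (-m) x, translate X (-m) x') ⟨?_, ?_, ?_⟩
        · simp [hφ.map_translate, he]
        · simp only [Set.mem_iInter, Set.mem_ofPred_eq, translate_apply]
          exact fun j hj => ih _ (by omega) (by omega)
        · simpa using hne
  exact fun j hj => key j.natAbs j (by omega) (by omega)

/-- A bi-closing code is uniformly injective: distinct points with the same image
differ on a fixed central window. -/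
lemma IsBiclosing.exists_window (hφ : IsCode φ) (h : IsBiclosing φ) :
    ∃ N : ℕ, ∀ x x' : X.carrier, φ x = φ x' → AgreeOn N x.1 x'.1 → x = x' := by
  obtain ⟨N₁, h₁⟩ := h.1.exists_bound hφ
  obtain ⟨N₂, h₂⟩ := h.2.exists_bound hφ
  refine ⟨max N₁ N₂, fun x x' he hx => Subtype.ext (funext fun j => ?_)⟩
  rcases le_total j 0 with hj | hj
  · exact h₁ x x' he (fun i h0 hi => hx i (by rw [abs_of_nonneg h0]; push_cast; omega)) j hj
  · exact h₂ x x' he (fun i hi h0 => hx i (by rw [abs_of_nonpos h0]; push_cast; omega)) j hj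

/-- A bi-closing code has a maximal number of preimages. -/
lemma IsBiclosing.exists_isGreatest [Nonempty Y.carrier] (hφ : IsCode φ) (h : IsBiclosing φ) :
    ∃ d : ℕ, IsGreatest (Set.range fun y : Y.carrier => (φ ⁻¹' {y}).encard) (d : ℕ∞) := by
  obtain ⟨N, hN⟩ := h.exists_window hφ
  have hle : ∀ y : Y.carrier,
      (φ ⁻¹' {y}).encard ≤ Nat.card (Set.Icc (-N : ℤ) N → A) := fun y => by
    have hinj : Set.InjOn (fun x : X.carrier => block N x.1) (φ ⁻¹' {y}) :=
      fun x hx x' hx' he => hN x x' (hx.trans hx'.symm) (block_eq_iff.mp he)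
    rw [← hinj.encard_image]
    refine (Set.encard_le_encard (Set.subset_univ _)).trans_eq ?_
    rw [Set.encard_univ, ENat.card_eq_coe_natCard]
  let S : Set ℕ := {k | ∃ y : Y.carrier, (φ ⁻¹' {y}).encard = k}
  have hS : BddAbove S :=
    ⟨Nat.card (Set.Icc (-N : ℤ) N → A), fun k ⟨y, hy⟩ => by exact_mod_cast hy ▸ hle y⟩
  have hmem : ∀ y : Y.carrier, ∃ k ∈ S, (φ ⁻¹' {y}).encard = k := fun y => by
    obtain ⟨k, hk⟩ := ENat.ne_top_iff_exists.mp ((hle y).trans_lt (ENat.natCast_lt_top _)).ne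
    exact ⟨k, ⟨y, hk.symm⟩, hk.symm⟩
  have hne : S.Nonempty := by
    obtain ⟨k, hk, -⟩ := hmem (Classical.arbitrary _)
    exact ⟨k, hk⟩
  refine ⟨sSup S, Nat.sSup_mem hne hS, ?_⟩
  rintro _ ⟨y, rfl⟩
  obtain ⟨k, hk, he⟩ := hmem y
  simp only [he]
  exact_mod_cast le_csSup hS hk

lemma exists_injOn_lt_ncard {α : Type*} {S : Set α} (hS : S.Finite) :
    ∃ g : α → ℕ, Set.InjOn g S ∧ ∀ a ∈ S, g a < S.ncard := by
  classical
  have := hS.fintype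
  let e := Fintype.equivFin S
  refine ⟨fun a => if h : a ∈ S then e ⟨a, h⟩ else 0, fun a ha b hb hab => ?_, fun a ha => ?_⟩
  · simp only [ha, hb, dif_pos, Fin.val_inj, e.apply_eq_iff_eq, Subtype.mk.injEq] at hab
    exact hab
  · simp only [ha, dif_pos]
    exact (e ⟨a, ha⟩).2.trans_eq (by rw [Set.ncard_eq_toFinset_card', Set.toFinset_card])

/-- The points of a subshift with a bi-closing code of maximal fibre size `d` can be labelled
continuously by `d` labels so that points of a common fibre have different labels. -/
lemma IsBiclosing.exists_label (hφ : IsCode φ) (h : IsBiclosing φ) {d : ℕ}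
    (hd : ∀ y : Y.carrier, (φ ⁻¹' {y}).encard ≤ d) :
    ∃ l : X.carrier → ℕ, Continuous l ∧ (∀ x, l x < d) ∧
      ∀ x x', φ x = φ x' → l x = l x' → x = x' := by
  obtain ⟨N, hN⟩ := h.exists_window hφ
  -- Otherwise compactness gives `d + 1` points with pairwise distinct `N`-blocks whose images agree
  -- on every window, hence `d + 1` points in one fibre.
  obtain ⟨k, hk⟩ := exists_forall_notMem_of_antitone (T := Fin (d + 1) → X.carrier)
    (F := fun k => {p | ∀ i j, AgreeOn k (φ (p i)).1 (φ (p j)).1} ∩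
      {p | Function.Injective fun i => block N (p i).1})
    (fun r s hrs p hp => ⟨fun i j => (hp.1 i j).mono hrs, hp.2⟩)
    (fun k => by
      have hφ' := hφ.continuous
      refine IsClosed.inter ?_ ?_
      · simp only [Set.ofPred_forall]
        exact isClosed_iInter fun i => isClosed_iInter fun j =>
          isClosed_agreeOn (f := fun p : Fin (d + 1) → X.carrier => (φ (p i)).1)
            (g := fun p : Fin (d + 1) → X.carrier => (φ (p j)).1) (by fun_prop) (by fun_prop) k
      · exact (isClosed_discrete
          {q : Fin (d + 1) → Set.Icc (-N : ℤ) N → A | Function.Injective q}).preimage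
          (f := fun (p : Fin (d + 1) → X.carrier) i => block N (p i).1)
          (continuous_pi fun i => (continuous_block N).comp
            (continuous_subtype_val.comp (continuous_apply i))))
    (fun p => by
      by_contra! hall
      have he : ∀ i, p i ∈ φ ⁻¹' {φ (p 0)} := fun i =>
        Subtype.ext (funext fun j => (hall j.natAbs).1 i 0 j (by simp))
      have hinj : Function.Injective p := fun i j hij => (hall 0).2 (by simp [hij])
      have h1 : (Set.range p).encard ≤ d :=
        (Set.encard_le_encard (Set.range_subset_iff.mpr he)).trans (hd _)
      rw [← Set.image_univ, hinj.encard_image, Set.encard_univ, ENat.card_eq_coe_natCard,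
        Nat.card_eq_fintype_card, Fintype.card_fin] at h1
      have h2 : d + 1 ≤ d := by exact_mod_cast h1
      omega)
  -- The `N`-blocks lying over an image block `b`. The choice of `k` allows at most `d` of them, and
  -- numbering them gives the label.
  let Bl : (Set.Icc (-k : ℤ) k → C) → Set (Set.Icc (-N : ℤ) N → A) := fun b =>
    {c | ∃ x : X.carrier, block k (φ x).1 = b ∧ block N x.1 = c}
  have hcard : ∀ b, (Bl b).ncard ≤ d := fun b => by
    by_contra! hlt
    obtain ⟨e⟩ : Nonempty (Fin (d + 1) ↪ Bl b) := by
      have : Fintype (Bl b) := Fintype.ofFinite _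
      refine Function.Embedding.nonempty_of_card_le ?_
      rw [Fintype.card_fin, ← Nat.card_eq_fintype_card, Nat.card_coe_set_eq]
      exact hlt
    choose p hp1 hp2 using fun i => (e i).2
    refine hk p ⟨fun i j => block_eq_iff.mp ((hp1 i).trans (hp1 j).symm), fun i j hij => ?_⟩
    exact e.injective (Subtype.ext ((hp2 i).symm.trans (hij.trans (hp2 j))))
  choose g hg1 hg2 using fun b => exists_injOn_lt_ncard (Bl b).toFinite
  refine ⟨fun x => g (block k (φ x).1) (block N x.1), ?_, fun x => ?_, fun x x' he hl => ?_⟩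
  · exact (continuous_of_discreteTopology (f := fun q : (Set.Icc (-k : ℤ) k → C) ×
      (Set.Icc (-N : ℤ) N → A) => g q.1 q.2)).comp
      (((continuous_block k).comp (continuous_subtype_val.comp hφ.continuous)).prodMk
        ((continuous_block N).comp continuous_subtype_val))
  · exact (hg2 _ _ ⟨x, rfl, rfl⟩).trans_le (hcard _)
  · simp only [he] at hl
    exact hN x x' he (block_eq_iff.mp (hg1 _ ⟨x, by rw [he], rfl⟩ ⟨x', rfl, rfl⟩ hl))

end Closing

/-- A factor of a subshift does not have larger entropy. -/
lemma entropy_le_of_surjective {A : Type u} [TopologicalSpace A] [DiscreteTopology A] [Finite A]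
    {C : Type v} [TopologicalSpace C] [DiscreteTopology C]
    {X : Subshift A ℤ} {Y : Subshift C ℤ} {φ : X.carrier → Y.carrier} (hφ : IsCode φ)
    (hs : Function.Surjective φ) : entropy Y ≤ entropy X := by
  have hA := DiscreteTopology.eq_bot (α := A)
  have hC := DiscreteTopology.eq_bot (α := C)
  subst hA hC
  let _ : UniformSpace A := ⊥
  let _ : UniformSpace C := ⊥
  have h := Dynamics.coverEntropy_image_le_of_uniformContinuous (S := shiftMap X)
    (T := shiftMap Y) hφ.comm (CompactSpace.uniformContinuous_of_continuous hφ.continuous) Set.univ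
  rw [Set.image_univ, hs.range_eq] at h
  have hX := Dynamics.coverEntropy_restrict (X.mapsTo 1)
  have hY := Dynamics.coverEntropy_restrict (Y.mapsTo 1)
  exact (hY.symm.trans_le h).trans_eq hX

/-! ### Strongly connected finite covers of a graph -/

section SkewProduct

open Relation

/-- Reachability by paths in the graph with edges `e : src e → tgt e`. -/
def Reachable {V E : Type*} (src tgt : E → V) : V → V → Prop :=
  ReflTransGen fun a b => ∃ e, src e = a ∧ tgt e = b

variable {V E L : Type*} {src tgt : E → V}

/-- Source map of the skew product of a graph with permutations of a set of labels. -/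
def skewSrc (src : E → V) : E × L → V × L := fun p => (src p.1, p.2)

/-- Target map of the skew product of a graph with permutations of a set of labels. -/
def skewTgt (tgt : E → V) (π : E → Equiv.Perm L) : E × L → V × L :=
  fun p => (tgt p.1, π p.1 p.2)

/-- Reachability in the skew product. -/
abbrev SkewReachable (src tgt : E → V) (π : E → Equiv.Perm L) : V × L → V × L → Prop :=
  Reachable (skewSrc src) (skewTgt tgt π)

lemma SkewReachable.edge (π : E → Equiv.Perm L) (e : E) (i : L) :
    SkewReachable src tgt π (src e, i) (tgt e, π e i) :=
  ReflTransGen.single ⟨(e, i), rfl, rfl⟩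

lemma exists_skewReachable_lift (π : E → Equiv.Perm L) {v w : V} (h : Reachable src tgt v w)
    (i : L) : ∃ j, SkewReachable src tgt π (v, i) (w, j) := by
  induction h with
  | refl => exact ⟨i, ReflTransGen.refl⟩
  | tail _ hs ih =>
    obtain ⟨j, hj⟩ := ih
    obtain ⟨e, rfl, rfl⟩ := hs
    exact ⟨π e j, hj.trans (SkewReachable.edge π e j)⟩

/-- In a finite covering of a strongly connected graph, reachability is symmetric. -/
lemma SkewReachable.symm [Finite L] (hsc : ∀ v w, Reachable src tgt v w)
    {π : E → Equiv.Perm L} {p q : V × L} (h : SkewReachable src tgt π p q) :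
    SkewReachable src tgt π q p := by
  induction h with
  | refl => exact ReflTransGen.refl
  | @tail b c _ hs ih =>
    refine ReflTransGen.trans ?_ ih
    obtain ⟨⟨e, i⟩, rfl, rfl⟩ := hs
    -- Edge permutations map these sets injectively into one another, so their size cannot drop
    -- along a path. Strong connectivity makes it constant, hence `π e` maps `S (src e)` onto `S
    -- (tgt e)`.
    let S : V → Set L := fun w => {j | SkewReachable src tgt π (tgt e, π e i) (w, j)}
    have hmaps : ∀ f, π f '' S (src f) ⊆ S (tgt f) := by
      rintro f _ ⟨j, hj, rfl⟩
      exact ReflTransGen.trans hj (SkewReachable.edge π f j)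
    have hcard : ∀ v w, (S v).ncard ≤ (S w).ncard := by
      intro v w
      induction hsc v w with
      | refl => exact le_rfl
      | tail _ hs ih =>
        obtain ⟨f, rfl, rfl⟩ := hs
        refine ih.trans ?_
        rw [← Set.ncard_image_of_injective _ (π f).injective]
        exact Set.ncard_le_ncard (hmaps f)
    have heq : π e '' S (src e) = S (tgt e) := by
      refine Set.eq_of_subset_of_ncard_le (hmaps e) ?_
      rw [Set.ncard_image_of_injective _ (π e).injective]
      exact hcard _ _
    have hi : π e i ∈ π e '' S (src e) := heq ▸ ReflTransGen.refl
    obtain ⟨j, hj, hji⟩ := hi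
    rw [(π e).injective hji] at hj
    exact hj

/-- A partial injection of a finite set extends to a permutation. -/
lemma exists_perm_extending [Finite L] {R : L → L → Prop}
    (hR : ∀ i j i' j', R i j → R i' j' → (i = i' ↔ j = j')) :
    ∃ σ : Equiv.Perm L, ∀ i j, R i j → σ i = j := by
  classical
  have := Fintype.ofFinite L
  let f : L → L := fun i => if h : ∃ j, R i j then h.choose else i
  have hf : ∀ i j, R i j → f i = j := fun i j h => by
    have hex : ∃ j, R i j := ⟨j, h⟩
    simp only [f, dif_pos hex]
    exact (hR _ _ _ _ hex.choose_spec h).mp rfl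
  obtain ⟨g, hg⟩ := Set.MapsTo.exists_equiv_extend_of_card_eq (t := Finset.univ)
    (s := {i | ∃ j, R i j}) (f := f) Finset.card_univ.symm (fun i _ => by simp)
    (by
      rintro i ⟨j, hj⟩ i' ⟨j', hj'⟩ he
      rw [hf i j hj, hf i' j' hj'] at he
      exact (hR _ _ _ _ hj hj').mpr he)
  refine ⟨g.trans (Equiv.subtypeUnivEquiv Finset.mem_univ), fun i j h => ?_⟩
  simp [Equiv.subtypeUnivEquiv, hg i ⟨j, h⟩, hf i j h]

section Swap

variable [DecidableEq E] [DecidableEq L]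

/-- Interchange the targets of the lifts `(e₀, i)` and `(e₀, i')` of an edge. -/
def swapTargets (π : E → Equiv.Perm L) (e₀ : E) (i i' : L) : E → Equiv.Perm L :=
  Function.update π e₀ (π e₀ * Equiv.swap i i')

lemma swapTargets_apply_of_ne (π : E → Equiv.Perm L) {e₀ e : E} {i i' j : L}
    (h : ¬ (e = e₀ ∧ (j = i ∨ j = i'))) : swapTargets π e₀ i i' e j = π e j := by
  by_cases he : e = e₀
  · subst he
    simp only [true_and, not_or] at h
    simp [swapTargets, Equiv.swap_apply_of_ne_of_ne h.1 h.2]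
  · simp [swapTargets, he]

lemma SkewReachable.swapTargets_of_ne (π : E → Equiv.Perm L) {e₀ e : E} {i i' j : L}
    (h : ¬ (e = e₀ ∧ (j = i ∨ j = i'))) :
    SkewReachable src tgt (swapTargets π e₀ i i') (src e, j) (tgt e, π e j) := by
  rw [← swapTargets_apply_of_ne π h]
  exact SkewReachable.edge _ e j

/-- Paths to the source of a swapped edge survive if the other swapped edge is elsewhere. -/
lemma SkewReachable.swapTargets_to_src {π : E → Equiv.Perm L} {e₀ : E} {i i' : L}
    (h : ¬ SkewReachable src tgt π (src e₀, i') (src e₀, i)) {a : V × L}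
    (ha : SkewReachable src tgt π a (src e₀, i)) :
    SkewReachable src tgt (swapTargets π e₀ i i') a (src e₀, i) := by
  induction ha using ReflTransGen.head_induction_on with
  | refl => exact ReflTransGen.refl
  | head hs hb ih =>
    obtain ⟨⟨e, j⟩, rfl, rfl⟩ := hs
    by_cases hc : e = e₀ ∧ (j = i ∨ j = i')
    · obtain ⟨rfl, rfl | rfl⟩ := hc
      · exact ReflTransGen.refl
      · exact absurd (ReflTransGen.head ⟨(e, j), rfl, rfl⟩ hb) h
    · exact (SkewReachable.swapTargets_of_ne π hc).trans ih

/-- Each of the two lifted edges lies on a cycle in its own component. The swap joins the two cycles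
into one, so both components survive and become connected to each other. -/
lemma SkewReachable.swapTargets [Finite L] (hsc : ∀ v w, Reachable src tgt v w)
    {π : E → Equiv.Perm L} {e₀ : E} {i i' : L}
    (h : ¬ SkewReachable src tgt π (src e₀, i) (src e₀, i')) :
    (∀ p q, SkewReachable src tgt π p q →
      SkewReachable src tgt (swapTargets π e₀ i i') p q) ∧
    SkewReachable src tgt (swapTargets π e₀ i i') (src e₀, i) (src e₀, i') := by
  have h' : ¬ SkewReachable src tgt π (src e₀, i') (src e₀, i) := fun h' => h (h'.symm hsc)
  have hcomm : BiclosingExtension.swapTargets π e₀ i' i =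
      BiclosingExtension.swapTargets π e₀ i i' := by
    simp [BiclosingExtension.swapTargets, Equiv.swap_comm]
  have h1 := SkewReachable.swapTargets_to_src h' ((SkewReachable.edge π e₀ i).symm hsc)
  have h2 := SkewReachable.swapTargets_to_src h ((SkewReachable.edge π e₀ i').symm hsc)
  rw [hcomm] at h2
  refine ⟨fun p q hpq => ?_, ?_⟩
  · induction hpq with
    | refl => exact ReflTransGen.refl
    | tail _ hs ih =>
      refine ReflTransGen.trans ih ?_
      obtain ⟨⟨e, j⟩, rfl, rfl⟩ := hs
      by_cases hc : e = e₀ ∧ (j = i ∨ j = i')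
      · obtain ⟨rfl, rfl | rfl⟩ := hc
        · exact h1.symm hsc
        · exact h2.symm hsc
      · exact SkewReachable.swapTargets_of_ne π hc
  · have h3 := SkewReachable.edge (src := src) (tgt := tgt)
      (BiclosingExtension.swapTargets π e₀ i i') e₀ i
    have h4 : BiclosingExtension.swapTargets π e₀ i i' e₀ i = π e₀ i' := by
      simp [BiclosingExtension.swapTargets]
    rw [h4] at h3
    exact h3.trans h2

end Swap

/-- A family of partial injections that leave one edge unused extends to a
strongly connected skew product. -/
theorem exists_skewProduct_connected [Finite V] [Finite E] [Finite L]
    (hsc : ∀ v w, Reachable src tgt v w) {R : E → L → L → Prop}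
    (hR : ∀ e i j i' j', R e i j → R e i' j' → (i = i' ↔ j = j'))
    {e₀ : E} (he₀ : ∀ i j, ¬ R e₀ i j) :
    ∃ π : E → Equiv.Perm L, (∀ e i j, R e i j → π e i = j) ∧
      ∀ p q, SkewReachable src tgt π p q := by
  classical
  choose π₀ hπ₀ using fun e => exists_perm_extending (hR e)
  let P := {π : E → Equiv.Perm L // ∀ e i j, R e i j → π e i = j}
  have : Nonempty P := ⟨⟨π₀, hπ₀⟩⟩
  -- Among the finitely many completions, one with the most reachable pairs admits no merging swap.
  let c : P → ℕ := fun π => {x : (V × L) × (V × L) | SkewReachable src tgt π.1 x.1 x.2}.ncard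
  obtain ⟨⟨π, hπ⟩, hmax⟩ := Finite.exists_max c
  refine ⟨π, hπ, ?_⟩
  have hfree : ∀ (e : E) (i i' : L), (∀ j, ¬ R e i j) → (∀ j, ¬ R e i' j) →
      SkewReachable src tgt π (src e, i) (src e, i') := by
    intro e i i' hi hi'
    by_contra hne
    obtain ⟨hs1, hs2⟩ := SkewReachable.swapTargets hsc hne
    have hext : ∀ f k j, R f k j → swapTargets π e i i' f k = j := fun f k j hk => by
      rw [swapTargets_apply_of_ne, hπ f k j hk]
      rintro ⟨rfl, rfl | rfl⟩
      · exact hi j hk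
      · exact hi' j hk
    have hlt : c ⟨π, hπ⟩ < c ⟨_, hext⟩ :=
      Set.ncard_lt_ncard (Set.ssubset_iff_of_subset (fun x hx => hs1 _ _ hx) |>.mpr
        ⟨((src e, i), (src e, i')), hs2, hne⟩)
    exact (hmax ⟨_, hext⟩).not_gt hlt
  intro p q
  -- Every component meets the fibre over `src e₀`, where all labels are free.
  obtain ⟨j, hj⟩ := exists_skewReachable_lift π (hsc p.1 (src e₀)) p.2
  obtain ⟨j', hj'⟩ := exists_skewReachable_lift π (hsc q.1 (src e₀)) q.2
  exact (hj.trans (hfree e₀ j j' (he₀ j) (he₀ j'))).trans (hj'.symm hsc)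

end SkewProduct

instance (G : FinGraph) : Finite G.E := G.finiteE

instance (G : FinGraph) : Finite G.V := G.finiteV

/-! ### Irreducible edge shifts and strongly connected graphs -/

section Irreducibility

open Relation

/-- A graph whose edge shift is irreducible and visits every vertex is strongly connected. -/
lemma reachable_of_isIrreducible {G : FinGraph} (h : IsIrreducible (edgeShift G))
    (hV : ∀ v, ∃ z : (edgeShift G).carrier, G.src (z.1 0) = v) (v w : G.V) :
    Reachable G.src G.tgt v w := by
  obtain ⟨z, hz⟩ := h
  have hvisit : ∀ (s : ℕ) (v : G.V), ∃ k : ℕ, s ≤ k ∧ G.src (z.1 k) = v := by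
    intro s v
    obtain ⟨a, ha⟩ := hV v
    have hopen : IsOpen {x : (edgeShift G).carrier | G.src (x.1 s) = v} :=
      (isOpen_discrete {e | G.src e = v}).preimage (continuous_coord _ (s : ℤ))
    obtain ⟨_, hx, k, rfl⟩ := hz.inter_open_nonempty _ hopen
      ⟨translate _ (-s) a, by simpa using ha⟩
    refine ⟨k + s, by omega, ?_⟩
    simpa [iterate_shiftMap] using hx
  obtain ⟨k, -, rfl⟩ := hvisit 0 v
  obtain ⟨l, hl, rfl⟩ := hvisit k w
  induction l, hl using Nat.le_induction with
  | base => exact ReflTransGen.refl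
  | succ l _ ih =>
    refine ReflTransGen.tail ih ⟨z.1 l, rfl, ?_⟩
    exact_mod_cast z.2 l

/-- A left infinite path ending in `v` and a right infinite path starting at `w` are joined by a
bi-infinite path if `w` is reachable from `v`. -/
lemma exists_glue {G : FinGraph} {v w : G.V} (h : Reachable G.src G.tgt v w) {b : ℤ → G.E}
    (hb : ∀ i : ℤ, 0 ≤ i → G.tgt (b i) = G.src (b (i + 1))) (hw : G.src (b 0) = w) {a : ℤ → G.E}
    (ha : ∀ i : ℤ, i < -1 → G.tgt (a i) = G.src (a (i + 1))) (hv : G.tgt (a (-1)) = v) :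
    ∃ (k : ℕ) (x : (edgeShift G).carrier), (∀ i < 0, x.1 i = a i) ∧
      ∀ i : ℤ, 0 ≤ i → x.1 (k + i) = b i := by
  induction h using ReflTransGen.head_induction_on generalizing a with
  | refl =>
    refine ⟨0, ⟨fun i => if i < 0 then a i else b i, fun i => ?_⟩, fun i hi => ?_, fun i hi => ?_⟩
    · rcases lt_trichotomy i (-1) with hi | rfl | hi
      · simpa [show i < 0 by omega, show i + 1 < 0 by omega] using ha i hi
      · simp [hv, hw]
      · simpa [show ¬ i < 0 by omega, show ¬ i + 1 < 0 by omega] using hb i (by omega)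
    · simp [hi]
    · simp [show ¬ i < 0 by omega]
  | head hs _ ih =>
    obtain ⟨e, rfl, rfl⟩ := hs
    -- The left path is moved one step back and `e` takes the freed place `-1`.
    obtain ⟨k, x, hx1, hx2⟩ := ih (a := fun i => if i < -1 then a (i + 1) else e)
      (fun i hi => by
        rcases (show i < -2 ∨ i = -2 by omega) with hi' | rfl
        · simpa [hi, show i + 1 < -1 by omega] using ha (i + 1) (by omega)
        · simpa using hv)
      (by simp)
    refine ⟨k + 1, translate _ (-1) x, fun i hi => ?_, fun i hi => ?_⟩
    · simp [hx1 (-1 + i) (by omega), show -1 + i < -1 by omega]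
    · rw [translate_apply, ← hx2 i hi]
      push_cast
      ring_nf

lemma exists_agreeOn_subset {A : Type u} [TopologicalSpace A] [T2Space A] [Finite A]
    {X : Subshift A ℤ} {U : Set X.carrier} (hU : IsOpen U) {z : X.carrier} (hz : z ∈ U) :
    ∃ M : ℕ, ∀ x : X.carrier, AgreeOn M x.1 z.1 → x ∈ U := by
  obtain ⟨M, hM⟩ := exists_window (T := X.carrier) (f := fun x => x.1) (g := fun _ => z.1)
    continuous_subtype_val continuous_const hU.isClosed_compl
    (fun x hx he => hx (by rwa [Subtype.ext he]))
  exact ⟨M, fun x hx => by_contra fun h => hM x h hx⟩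

/-- The edge shift of a strongly connected graph is irreducible. -/
lemma isIrreducible_of_reachable {G : FinGraph} (h : ∀ v w, Reachable G.src G.tgt v w)
    [Nonempty (edgeShift G).carrier] : IsIrreducible (edgeShift G) := by
  have htrans : ∀ U W : Set (edgeShift G).carrier, IsOpen U → U.Nonempty → IsOpen W →
      W.Nonempty → ∃ (k : ℕ) (x : _), x ∈ W ∧ translate (edgeShift G) k x ∈ U := by
    rintro U W hU ⟨b, hb⟩ hW ⟨a, ha⟩
    obtain ⟨M₁, h₁⟩ := exists_agreeOn_subset hU hb
    obtain ⟨M₂, h₂⟩ := exists_agreeOn_subset hW ha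
    let M := max M₁ M₂
    -- The translates put coordinate `M` of `a` at `-1` and coordinate `-M` of `b` at `0`, so both
    -- central blocks occur in the glued path.
    obtain ⟨k, x, hx1, hx2⟩ := exists_glue (h (G.tgt (a.1 M)) (G.src (b.1 (-M))))
      (b := (translate _ (-M) b).1) (a := (translate _ (M + 1) a).1)
      (fun i _ => (translate _ _ b).2 i) (by simp) (fun i _ => (translate _ _ a).2 i) (by simp)
    refine ⟨k + 2 * M + 1, translate _ (-(M + 1)) x, h₂ _ ?_, h₁ _ ?_⟩
    · refine AgreeOn.mono (le_max_right M₁ M₂) fun j hj => ?_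
      rw [abs_le] at hj
      rw [translate_apply, hx1 _ (by omega), translate_apply]
      ring_nf
    · refine AgreeOn.mono (le_max_left M₁ M₂) fun j hj => ?_
      rw [abs_le] at hj
      have := hx2 (M + j) (by omega)
      rw [translate_apply] at this
      rw [translate_translate, translate_apply]
      convert this using 2
      · push_cast
        ring
      · ring
  let 𝓑 := TopologicalSpace.countableBasis (edgeShift G).carrier
  -- Baire category: the points whose forward orbit meets every basic open set are dense.
  have hdense : Dense (⋂ U ∈ 𝓑, ⋃ k : ℕ, translate (edgeShift G) k ⁻¹' U) := by
    refine dense_biInter_of_isOpen (fun U hU => isOpen_iUnion fun k =>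
      (TopologicalSpace.isOpen_of_mem_countableBasis hU).preimage (continuous_translate _ _))
      (TopologicalSpace.countable_countableBasis _) fun U hU => ?_
    rw [dense_iff_inter_open]
    intro W hW hWne
    obtain ⟨k, x, hxW, hxU⟩ := htrans U W (TopologicalSpace.isOpen_of_mem_countableBasis hU)
      (TopologicalSpace.nonempty_of_mem_countableBasis hU) hW hWne
    exact ⟨x, hxW, Set.mem_iUnion.mpr ⟨k, hxU⟩⟩
  obtain ⟨x, hx⟩ := hdense.nonempty
  refine ⟨x, (TopologicalSpace.isBasis_countableBasis _).dense_iff.mpr fun U hU _ => ?_⟩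
  obtain ⟨k, hk⟩ := Set.mem_iUnion.mp (Set.mem_iInter₂.mp hx U hU)
  exact ⟨_, hk, k, iterate_shiftMap _ _ _⟩

end Irreducibility

/-! ### Block presentations of a shift of finite type -/

section BlockGraph

/-- The graph whose edges are the blocks of radius `r` of an edge shift. -/
def blockGraph (G : FinGraph) (r : ℕ) : FinGraph where
  V := {b : Set.Ico (-r : ℤ) r → G.E //
    ∃ y : (edgeShift G).carrier, b = fun j : Set.Ico _ _ => y.1 j}
  E := {b : Set.Icc (-r : ℤ) r → G.E // ∃ y : (edgeShift G).carrier, b = block r y.1}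
  finiteV := inferInstance
  finiteE := inferInstance
  src b := ⟨fun j => b.1 ⟨j, j.2.1, j.2.2.le⟩, by
    obtain ⟨_, y, rfl⟩ := b
    exact ⟨y, rfl⟩⟩
  tgt b := ⟨fun j => b.1 ⟨1 + j, by have := j.2; simp only [Set.mem_Ico, Set.mem_Icc] at *; omega⟩,
    by
      obtain ⟨_, y, rfl⟩ := b
      exact ⟨translate _ 1 y, rfl⟩⟩

/-- The block code from an edge shift to the edge shift of its block graph. -/
def toBlockGraph (G : FinGraph) (r : ℕ) (y : (edgeShift G).carrier) :
    (edgeShift (blockGraph G r)).carrier :=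
  ⟨fun t => ⟨block r (translate _ t y).1, translate _ t y, rfl⟩, fun t => Subtype.ext <| by
    funext j
    simp [blockGraph, block, add_assoc]⟩

lemma toBlockGraph_apply (G : FinGraph) (r : ℕ) (y : (edgeShift G).carrier) (t : ℤ) :
    ((toBlockGraph G r y).1 t).1 = block r (translate _ t y).1 := rfl

lemma isCode_toBlockGraph (G : FinGraph) (r : ℕ) : IsCode (toBlockGraph G r) := by
  refine ⟨?_, fun y => ?_⟩
  · refine Continuous.subtype_mk (continuous_pi fun t => ?_) _
    refine continuous_discrete_rng.mpr fun b => ?_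
    have : (fun y : (edgeShift G).carrier => (toBlockGraph G r y).1 t) ⁻¹' {b} =
        (fun y => block r (translate _ t y).1) ⁻¹' {b.1} := by
      ext y
      exact Subtype.ext_iff
    change IsOpen ((fun y : (edgeShift G).carrier => (toBlockGraph G r y).1 t) ⁻¹' {b})
    rw [this]
    exact (isOpen_discrete _).preimage ((continuous_block r).comp
      (continuous_subtype_val.comp (continuous_translate _ t)))
  · ext t : 2
    refine Subtype.ext ?_
    rw [shiftMap_apply, toBlockGraph_apply, toBlockGraph_apply, shiftMap_eq_translate,
      translate_translate]

lemma bijective_toBlockGraph (G : FinGraph) {r : ℕ} (hr : 1 ≤ r) :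
    Function.Bijective (toBlockGraph G r) := by
  refine ⟨fun y y' h => ?_, fun z => ?_⟩
  · ext t
    have h1 := congrArg (fun z => (z.1 t).1 ⟨0, by simp⟩) h
    simpa [toBlockGraph_apply, block] using h1
  · have hstep : ∀ (t j : ℤ) (h1 : -(r : ℤ) ≤ j) (h2 : j < r),
        (z.1 t).1 ⟨1 + j, by omega, by omega⟩ = (z.1 (1 + t)).1 ⟨j, h1, h2.le⟩ := by
      intro t j h1 h2
      have h := congrArg (fun v => v.1 ⟨j, h1, h2⟩) (z.2 t)
      rw [add_comm t 1] at h
      exact h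
    -- Successive blocks overlap, so every entry of a block is the central entry of another one.
    have hval : ∀ (t : ℤ) (j : ℤ) (hj : j ∈ Set.Icc (-r : ℤ) r),
        (z.1 t).1 ⟨j, hj⟩ = (z.1 (t + j)).1 ⟨0, by simp⟩ := by
      intro t j
      induction j using Int.induction_on generalizing t with
      | zero => simp
      | succ i ih =>
        intro hj
        obtain ⟨h1, h2⟩ := hj
        have h3 := hstep t i (by omega) (by omega)
        simp only [add_comm (1 : ℤ) (i : ℤ)] at h3
        rw [h3, ih (1 + t) ⟨by omega, by omega⟩]
        ring_nf
      | pred i ih =>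
        intro hj
        obtain ⟨h1, h2⟩ := hj
        have h3 := hstep (t - 1) (-i - 1) (by omega) (by omega)
        simp only [add_sub_cancel] at h3
        rw [← h3, ih (t - 1) ⟨by omega, by omega⟩]
        ring_nf
    refine ⟨⟨fun t => (z.1 t).1 ⟨0, by simp⟩, fun t => ?_⟩, ?_⟩
    · change G.tgt ((z.1 t).1 ⟨0, by simp⟩) = G.src ((z.1 (t + 1)).1 ⟨0, by simp⟩)
      -- As `r ≥ 1`, both edges lie in the one block at time `t`, which occurs in a genuine path.
      rw [← hval t 1 ⟨by omega, by omega⟩]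
      obtain ⟨y, hy⟩ := (z.1 t).2
      rw [hy]
      exact y.2 0
    · ext t : 2
      refine Subtype.ext (funext fun j => ?_)
      rw [toBlockGraph_apply, hval t j j.2]
      rfl

/-- An irreducible shift of finite type is conjugate to the edge shift of a strongly connected
graph by a conjugacy whose edge at time `0` determines a given window. -/
lemma exists_strongly_connected_presentation {C : Type v} [TopologicalSpace C]
    [DiscreteTopology C] [Finite C] {Y : Subshift C ℤ} (hY : IsSFT Y) (hYirr : IsIrreducible Y)
    (m : ℕ) : ∃ (H : FinGraph) (χ : Y.carrier → (edgeShift H).carrier), IsCode χ ∧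
      Function.Bijective χ ∧ (∀ v w, Reachable H.src H.tgt v w) ∧
      ∀ y y', (χ y).1 0 = (χ y').1 0 → AgreeOn m y.1 y'.1 := by
  obtain ⟨G, χ, hχ, hb⟩ := hY
  obtain ⟨r, hr⟩ := exists_window_of_factors hχ.continuous
    ((continuous_block m).comp continuous_subtype_val)
    (fun y y' h => by rw [hb.injective h])
  have hcode := (isCode_toBlockGraph G (r + 1)).comp hχ
  have hbij := (bijective_toBlockGraph G (r := r + 1) (by omega)).comp hb
  refine ⟨blockGraph G (r + 1), _, hcode, hbij,
    reachable_of_isIrreducible (hYirr.of_surjective hcode hbij.surjective) ?_, fun y y' h => ?_⟩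
  · rintro ⟨_, y, rfl⟩
    exact ⟨toBlockGraph G _ y, Subtype.ext (by
      funext j
      simp [blockGraph, toBlockGraph, block])⟩
  · refine block_eq_iff.mp (hr y y' (AgreeOn.mono r.le_succ ?_))
    have h1 := congrArg Subtype.val h
    simp only [Function.comp, toBlockGraph_apply, translate_zero] at h1
    exact block_eq_iff.mp h1

end BlockGraph

/-! ### The edge shift of a skew product -/

section SkewGraph

/-- The skew product of a graph with permutations of `n` labels. -/
def skewGraph (H : FinGraph) {n : ℕ} (π : H.E → Equiv.Perm (Fin n)) : FinGraph where
  V := H.V × Fin n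
  E := H.E × Fin n
  finiteV := inferInstance
  finiteE := inferInstance
  src := skewSrc H.src
  tgt := skewTgt H.tgt π

variable {H : FinGraph} {n : ℕ} {π : H.E → Equiv.Perm (Fin n)}

lemma mem_edgeShift_skewGraph {z : ℤ → (skewGraph H π).E} :
    z ∈ (edgeShift (skewGraph H π)).carrier ↔ ∀ t, H.tgt (z t).1 = H.src (z (t + 1)).1 ∧
      π (z t).1 (z t).2 = (z (t + 1)).2 :=
  forall_congr' fun _ => Prod.mk_inj

/-- The projection of the edge shift of a skew product to the edge shift of the base graph. -/
def skewProj (π : H.E → Equiv.Perm (Fin n)) (z : (edgeShift (skewGraph H π)).carrier) :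
    (edgeShift H).carrier :=
  ⟨fun t => (z.1 t).1, fun t => (mem_edgeShift_skewGraph.mp z.2 t).1⟩

lemma isCode_skewProj : IsCode (skewProj π) := by
  refine ⟨Continuous.subtype_mk (continuous_pi fun t => ?_) _, fun z => rfl⟩
  exact (continuous_of_discreteTopology (f := fun p : (skewGraph H π).E => p.1)).comp
    (continuous_coord _ t)

/-- Permutations of a set along `ℤ` carry every initial value to a bi-infinite sequence. -/
lemma exists_orbit {L : Type*} (p : ℤ → Equiv.Perm L) (i : L) :
    ∃ s : ℤ → L, s 0 = i ∧ ∀ t, p t (s t) = s (t + 1) := by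
  -- Carrying time along makes the varying permutations powers of a single one, so negative times
  -- need no separate construction.
  let T : Equiv.Perm (ℤ × L) :=
    { toFun := fun q => (q.1 + 1, p q.1 q.2)
      invFun := fun q => (q.1 - 1, (p (q.1 - 1)).symm q.2)
      left_inv := fun q => by simp
      right_inv := fun q => by simp }
  have hsucc : ∀ t : ℤ, (T ^ (t + 1)) (0, i) = T ((T ^ t) (0, i)) := fun t => by
    rw [add_comm, zpow_one_add, Equiv.Perm.mul_apply]
  have hfst : ∀ t : ℤ, ((T ^ t) (0, i)).1 = t := by
    intro t
    induction t using Int.induction_on with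
    | zero => simp
    | succ t ih =>
      rw [hsucc]
      change ((T ^ (t : ℤ)) (0, i)).1 + 1 = _
      rw [ih]
    | pred t ih =>
      have h := hsucc (-t - 1)
      rw [sub_add_cancel] at h
      have h1 : ((T ^ (-t : ℤ)) (0, i)).1 = ((T ^ (-t - 1 : ℤ)) (0, i)).1 + 1 := by
        rw [h]
        rfl
      omega
  refine ⟨fun t => ((T ^ t) (0, i)).2, by simp, fun t => ?_⟩
  simp only [hsucc]
  change _ = p ((T ^ t) (0, i)).1 _
  rw [hfst]

/-- The projection of a skew product with `n` labels is `n`-to-one. -/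
lemma encard_skewProj_preimage (y : (edgeShift H).carrier) :
    (skewProj π ⁻¹' {y}).encard = n := by
  have hinj : Set.InjOn (fun z : (edgeShift (skewGraph H π)).carrier => (z.1 0).2)
      (skewProj π ⁻¹' {y}) := by
    intro z hz z' hz' h0
    have hfst : ∀ t, (z.1 t).1 = (z'.1 t).1 := fun t =>
      congrArg (fun x : (edgeShift H).carrier => x.1 t) (Eq.trans hz (Eq.symm hz'))
    have hsnd : ∀ t, (z.1 t).2 = (z'.1 t).2 := by
      intro t
      induction t using Int.induction_on with
      | zero => exact h0
      | succ t ih =>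
        rw [← (mem_edgeShift_skewGraph.mp z.2 t).2, ← (mem_edgeShift_skewGraph.mp z'.2 t).2,
          hfst, ih]
      | pred t ih =>
        have h1 := (mem_edgeShift_skewGraph.mp z.2 (-t - 1)).2
        have h2 := (mem_edgeShift_skewGraph.mp z'.2 (-t - 1)).2
        rw [sub_add_cancel] at h1 h2
        rw [← h1, ← h2, hfst] at ih
        exact (π _).injective ih
    exact Subtype.ext (funext fun t => Prod.ext (hfst t) (hsnd t))
  have himg : (fun z : (edgeShift (skewGraph H π)).carrier => (z.1 0).2) ''
      (skewProj π ⁻¹' {y}) = Set.univ := by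
    refine Set.eq_univ_of_forall fun i => ?_
    obtain ⟨s, hs0, hs⟩ := exists_orbit (fun t => π (y.1 t)) i
    exact ⟨⟨fun t => (y.1 t, s t), mem_edgeShift_skewGraph.mpr fun t => ⟨y.2 t, hs t⟩⟩,
      rfl, hs0⟩
  rw [← hinj.encard_image, himg, Set.encard_univ, ENat.card_eq_coe_natCard, Nat.card_fin]

end SkewGraph

/-! ### Recoding an embedding as an inclusion of letters -/

/-- A subshift `Z` into which `X` embeds is conjugate to a subshift that contains `X` through an
embedding of letters. -/
lemma exists_recoding {A : Type u} [TopologicalSpace A] [DiscreteTopology A] [Finite A]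
    {D : Type} [TopologicalSpace D] [DiscreteTopology D] [Finite D]
    {X : Subshift A ℤ} {Z : Subshift D ℤ} {ψ : X.carrier → Z.carrier} (hψ : IsCode ψ)
    (hinj : Function.Injective ψ) :
    ∃ (B : Type u) (_ : Finite B) (_ : TopologicalSpace B) (_ : DiscreteTopology B) (ι : A ↪ B)
      (X' : Subshift B ℤ) (θ : Z.carrier → X'.carrier), IsCode θ ∧ Function.Bijective θ ∧
      ∀ x, (θ (ψ x)).1 = ι ∘ x.1 := by
  classical
  obtain ⟨r₁, hr₁⟩ := exists_window_of_factors hψ.continuous (continuous_coord X 0)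
    (fun x x' h => by rw [hinj h])
  obtain ⟨r₂, hr₂⟩ := exists_window_of_factors (φ := (id : X.carrier → X.carrier)) continuous_id
    ((continuous_coord Z 0).comp hψ.continuous) (fun x x' h => by rw [show x = x' from h])
  let M := r₁ + r₂
  let B := A ⊕ ULift.{u} (Set.Icc (-M : ℤ) M → D)
  let _ : TopologicalSpace B := ⊥
  have _ : DiscreteTopology B := ⟨rfl⟩
  -- A block seen in `ψ(X)` is replaced by the letter of `X` that it determines; any other block is
  -- kept as a new letter.
  let c : (Set.Icc (-M : ℤ) M → D) → B := fun b =>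
    if h : ∃ x : X.carrier, block M (ψ x).1 = b then Sum.inl (h.choose.1 0) else Sum.inr ⟨b⟩
  have hc : ∀ (x : X.carrier) (z : Z.carrier), block M z.1 = block M (ψ x).1 →
      c (block M z.1) = Sum.inl (x.1 0) := fun x z h => by
    have hex : ∃ x : X.carrier, block M (ψ x).1 = block M z.1 := ⟨x, h.symm⟩
    simp only [c, dif_pos hex]
    rw [hr₁ _ x ((block_eq_iff.mp (hex.choose_spec.trans h)).mono (Nat.le_add_right _ _))]
  have hc' : ∀ z z' : Z.carrier, c (block M z.1) = c (block M z'.1) →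
      block M z.1 = block M z'.1 ∨
        ∃ x x' : X.carrier, block M z.1 = block M (ψ x).1 ∧ block M z'.1 = block M (ψ x').1 := by
    intro z z' h
    by_cases hz : ∃ x : X.carrier, block M (ψ x).1 = block M z.1 <;>
      by_cases hz' : ∃ x : X.carrier, block M (ψ x).1 = block M z'.1
    · exact Or.inr ⟨hz.choose, hz'.choose, hz.choose_spec.symm, hz'.choose_spec.symm⟩
    · simp only [c, dif_pos hz, dif_neg hz'] at h
      exact absurd h Sum.inl_ne_inr
    · simp only [c, dif_neg hz, dif_pos hz'] at h
      exact absurd h Sum.inr_ne_inl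
    · simp only [c, dif_neg hz, dif_neg hz'] at h
      exact Or.inl (ULift.up_injective (Sum.inr_injective h))
  let Θ : Z.carrier → ℤ → B := fun z t => c (block M (translate Z t z).1)
  have hΘ : Continuous Θ := continuous_pi fun t =>
    (continuous_of_discreteTopology (f := c)).comp ((continuous_block M).comp
      (continuous_subtype_val.comp (continuous_translate Z t)))
  have hshift : ∀ (g : ℤ) (z : Z.carrier), shift g (Θ z) = Θ (translate Z g z) := fun g z => by
    funext t
    simp only [Θ, shift_apply, translate_translate]
  have hΘinj : Function.Injective Θ := by
    intro z z' h
    -- The preimages chosen at different times could differ. Since `M = r₁ + r₂`, the central block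
    -- fixes all letters at distance at most `r₂`, so they spell a single `x`.
    have hletter : ∀ (z : Z.carrier) (x : X.carrier), block M z.1 = block M (ψ x).1 →
        ∀ j : ℤ, |j| ≤ r₂ → ∀ w : X.carrier, block M (translate Z j z).1 = block M (ψ w).1 →
        Θ z j = Sum.inl (x.1 j) := by
      intro z x hx j hj w hw
      have hwx : w.1 0 = (translate X j x).1 0 := hr₁ _ _ fun i hi => by
        rw [← block_eq_iff.mp hw i (hi.trans (by simp [M])), hψ.map_translate, translate_apply,
          translate_apply]
        refine block_eq_iff.mp hx _ ((abs_add_le j i).trans ?_)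
        simp only [M]
        push_cast
        omega
      rw [translate_apply, add_zero] at hwx
      rw [← hwx]
      exact hc w _ hw
    have key : ∀ z z' : Z.carrier, Θ z = Θ z' → z.1 0 = z'.1 0 := by
      intro z z' h
      -- Either a nearby block is recovered and contains coordinate `0`, or all nearby blocks come
      -- from `ψ(X)` and the letters of `X` on the window `r₂` determine it.
      by_cases hex : ∃ s : ℤ, |s| ≤ M ∧
          block M (translate Z s z).1 = block M (translate Z s z').1
      · obtain ⟨s, hs, he⟩ := hex
        simpa using block_eq_iff.mp he (-s) (by rwa [abs_neg])
      · push Not at hex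
        have hpts := fun (s : ℤ) (hs : |s| ≤ M) =>
          (hc' (translate Z s z) (translate Z s z') (congrFun h s)).resolve_left (hex s hs)
        obtain ⟨x, x', hx, hx'⟩ := hpts 0 (by simp)
        rw [translate_zero] at hx hx'
        have hagree : AgreeOn r₂ x.1 x'.1 := fun j hj => by
          obtain ⟨w, w', hw, hw'⟩ := hpts j (hj.trans (by simp [M]))
          have h1 := hletter z x hx j hj w hw
          rw [h, hletter z' x' hx' j hj w' hw'] at h1
          exact (Sum.inl_injective h1).symm
        have h0 := hr₂ x x' hagree
        simp only [Function.comp] at h0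
        rw [block_eq_iff.mp hx 0 (by simp), block_eq_iff.mp hx' 0 (by simp), h0]
    ext t
    have ht := key (translate Z t z) (translate Z t z') (by rw [← hshift, ← hshift, h])
    simpa using ht
  let X' : Subshift B ℤ :=
    { carrier := Set.range Θ
      isClosed := (isCompact_range hΘ).isClosed
      mapsTo := by
        rintro g _ ⟨z, rfl⟩
        exact ⟨translate Z g z, (hshift g z).symm⟩ }
  refine ⟨B, inferInstance, inferInstance, inferInstance, ⟨Sum.inl, Sum.inl_injective⟩, X',
    Set.rangeFactorization Θ, ⟨hΘ.subtype_mk _, fun z => Subtype.ext (hshift 1 z).symm⟩,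
    ⟨fun z z' h => hΘinj (congrArg Subtype.val h), Set.rangeFactorization_surjective⟩, fun x => ?_⟩
  funext t
  change c (block M (translate Z t (ψ x)).1) = Sum.inl (x.1 t)
  rw [← hψ.map_translate, hc (translate X t x) _ rfl]
  simp

/-! ### Construction of the extension -/

/-- A code into an irreducible shift of finite type that misses a point of the target and whose
fibres are separated by a continuous labelling with `n` labels extends to an `n`-to-one code on an
irreducible shift of finite type. -/
theorem hasIrreducibleExtension_of_label {A : Type u} [TopologicalSpace A] [DiscreteTopology A]
    [Finite A] {C : Type v} [TopologicalSpace C] [DiscreteTopology C] [Finite C]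
    {X : Subshift A ℤ} {Y : Subshift C ℤ} (hY : IsSFT Y) (hYirr : IsIrreducible Y)
    {φ : X.carrier → Y.carrier} (hφ : IsCode φ) (hns : ¬ Function.Surjective φ)
    {n : ℕ} (hn : 0 < n) {l : X.carrier → Fin n} (hl : Continuous l)
    (hlφ : ∀ x x', φ x = φ x' → l x = l x' → x = x') : HasIrreducibleExtension φ n := by
  have hσ : Function.Injective (shiftMap X) := fun x x' h => by
    have := congrArg (translate X (-1)) h
    simpa [shiftMap_eq_translate, translate_translate, translate_zero] using this
  -- Both sides amount to `x = x'`. The window `m₁` extends the equivalence to points whose images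
  -- merely agree there, which makes `R` below a partial injection.
  have hiff : ∀ x x', φ x = φ x' → (l x = l x' ↔ l (shiftMap X x) = l (shiftMap X x')) :=
    fun x x' h => ⟨fun he => by rw [hlφ x x' h he], fun he => by
      rw [hσ (hlφ _ _ (by rw [hφ.comm, hφ.comm, h]) he)]⟩
  obtain ⟨m₁, hm₁⟩ := exists_window (T := X.carrier × X.carrier)
    (f := fun p => (φ p.1).1) (g := fun p => (φ p.2).1)
    (by have := hφ.continuous; fun_prop) (by have := hφ.continuous; fun_prop)
    (S := {p | ¬ (l p.1 = l p.2 ↔ l (shiftMap X p.1) = l (shiftMap X p.2))})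
    ((isClosed_discrete {q : (Fin n × Fin n) × (Fin n × Fin n) |
      ¬ (q.1.1 = q.1.2 ↔ q.2.1 = q.2.2)}).preimage
      (f := fun p : X.carrier × X.carrier =>
        ((l p.1, l p.2), (l (shiftMap X p.1), l (shiftMap X p.2))))
      (by have := continuous_translate X 1; rw [← shiftMap_eq_translate] at this; fun_prop))
    (fun p hp he => hp (hiff _ _ (Subtype.ext he)))
  simp only [Function.Surjective, not_forall, not_exists] at hns
  obtain ⟨y₀, hy₀⟩ := hns
  -- No image of `φ` shows the central block of `y₀` of radius `m₂`, so the edge of `y₀` is free.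
  obtain ⟨m₂, hm₂⟩ := exists_window (T := X.carrier) (f := fun x => (φ x).1) (g := fun _ => y₀.1)
    (continuous_subtype_val.comp hφ.continuous) continuous_const isClosed_univ
    (fun x _ he => hy₀ x (Subtype.ext he))
  obtain ⟨H, χ, hχ, hχb, hsc, hχm⟩ := exists_strongly_connected_presentation hY hYirr (max m₁ m₂)
  let R : H.E → Fin n → Fin n → Prop := fun e i j =>
    ∃ x, (χ (φ x)).1 0 = e ∧ l x = i ∧ l (shiftMap X x) = j
  obtain ⟨π, hπ, hπc⟩ := exists_skewProduct_connected hsc (R := R)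
    (by
      rintro e _ _ _ _ ⟨x, hx, rfl, rfl⟩ ⟨x', hx', rfl, rfl⟩
      by_contra hne
      exact hm₁ (x, x') hne ((hχm _ _ (hx.trans hx'.symm)).mono (le_max_left _ _)))
    (e₀ := (χ y₀).1 0)
    (by
      rintro _ _ ⟨x, hx, -⟩
      exact hm₂ x trivial ((hχm _ _ hx).mono (le_max_right _ _)))
  have hnonempty : ∀ y : (edgeShift H).carrier, (skewProj π ⁻¹' {y}).Nonempty := fun y => by
    rw [← Set.encard_ne_zero, encard_skewProj_preimage]
    exact_mod_cast hn.ne'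
  have : Nonempty (edgeShift (skewGraph H π)).carrier := ⟨(hnonempty (χ y₀)).some⟩
  have hirr : IsIrreducible (edgeShift (skewGraph H π)) := isIrreducible_of_reachable hπc
  let ψ : X.carrier → (edgeShift (skewGraph H π)).carrier := fun x =>
    ⟨fun t => ((χ (φ x)).1 t, l (translate X t x)), mem_edgeShift_skewGraph.mpr fun t =>
      ⟨(χ (φ x)).2 t, hπ _ _ _ ⟨translate X t x, by
        simp [hφ.map_translate, hχ.map_translate], rfl, by
        rw [shiftMap_eq_translate, translate_translate]⟩⟩⟩
  have hψ : IsCode ψ := by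
    refine ⟨Continuous.subtype_mk (continuous_pi fun t => ?_) _, fun x => ?_⟩
    · exact (continuous_of_discreteTopology (α := H.E × Fin n) (β := (skewGraph H π).E)
        (f := fun q => q)).comp
        (((continuous_coord _ t).comp (hχ.continuous.comp hφ.continuous)).prodMk
          (hl.comp (continuous_translate X t)))
    · refine Subtype.ext (funext fun t => Prod.ext ?_ ?_)
      · change (χ (φ (shiftMap X x))).1 t = (χ (φ x)).1 (1 + t)
        rw [hφ.comm, hχ.comm, shiftMap_apply]
      · change l (translate X t (shiftMap X x)) = l (translate X (1 + t) x)
        rw [shiftMap_eq_translate, translate_translate]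
  have hψχ : ∀ x, skewProj π (ψ x) = χ (φ x) := fun x => rfl
  have hψinj : Function.Injective ψ := fun x x' h => by
    refine hlφ x x' (hχb.injective (by rw [← hψχ, ← hψχ, h])) ?_
    have h0 : l (translate X 0 x) = l (translate X 0 x') :=
      congrArg (fun z : (edgeShift (skewGraph H π)).carrier => (z.1 0).2) h
    rwa [translate_zero, translate_zero] at h0
  obtain ⟨B, hB, tB, dB, ι, X', θ, hθ, hθb, hθψ⟩ := exists_recoding hψ hψinj
  obtain ⟨θi, hθi, hθl, hθr⟩ := hθ.exists_inverse hθb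
  obtain ⟨χi, hχi, hχl, hχr⟩ := hχ.exists_inverse hχb
  have hfib : ∀ y, (χi ∘ skewProj π ∘ θi) ⁻¹' {y} = θ '' (skewProj π ⁻¹' {χ y}) := fun y => by
    ext x
    simp only [Set.mem_preimage, Set.mem_singleton_iff, Function.comp, Set.mem_image]
    constructor
    · intro h
      exact ⟨θi x, by rw [← h, hχr], hθr x⟩
    · rintro ⟨z, hz, rfl⟩
      rw [hθl, hz, hχl]
  have hcard : ∀ y, ((χi ∘ skewProj π ∘ θi) ⁻¹' {y}).encard = n := fun y => by
    rw [hfib, hθb.injective.encard_image, encard_skewProj_preimage]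
  have hmem : ∀ x ∈ X.carrier, ι ∘ x ∈ X'.carrier := fun x hx =>
    hθψ ⟨x, hx⟩ ▸ (θ (ψ ⟨x, hx⟩)).2
  refine ⟨B, hB, tB, dB, ι, X', hmem, χi ∘ skewProj π ∘ θi,
    ⟨skewGraph H π, θi, hθi, hθr.injective, hθl.surjective⟩,
    hirr.of_surjective hθ hθb.surjective, hχi.comp (isCode_skewProj.comp hθi), fun x => ?_,
    fun y => ?_, hcard⟩
  · have hx : (⟨ι ∘ x.1, hmem x.1 x.2⟩ : X'.carrier) = θ (ψ x) := Subtype.ext (hθψ x).symm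
    rw [hx]
    simp only [Function.comp]
    rw [hθl, hψχ, hχl]
  · have hne : ((χi ∘ skewProj π ∘ θi) ⁻¹' {y}).Nonempty := by
      rw [hfib]
      exact (hnonempty _).image θ
    exact hne

end BiclosingExtension

theorem theorem4p3 {A : Type*} [TopologicalSpace A] [DiscreteTopology A] [Finite A]
    {C : Type*} [TopologicalSpace C] [DiscreteTopology C] [Finite C]
    (X : Subshift A ℤ) (Y : Subshift C ℤ)
    (hY : BiclosingExtension.IsSFT Y) (hYirr : BiclosingExtension.IsIrreducible Y)
    (hent : BiclosingExtension.entropy X < BiclosingExtension.entropy Y)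
    (φ : X.carrier → Y.carrier) (hφ : BiclosingExtension.IsCode φ)
    (hbc : BiclosingExtension.IsBiclosing φ) :
    -- `d` is the maximal number of preimages of a point of `Y`
    ∃ d : ℕ, IsGreatest (Set.range fun y : Y.carrier => (φ ⁻¹' {y}).encard) (d : ℕ∞) ∧
      (X.carrier.Nonempty → BiclosingExtension.IsSFT X → BiclosingExtension.IsIndecomposable X →
        ∀ n : ℕ, d ≤ n → BiclosingExtension.HasIrreducibleExtension φ n) ∧
      (BiclosingExtension.IsSFT X →
        ∀ n : ℕ, d + 1 ≤ n → BiclosingExtension.HasIrreducibleExtension φ n) ∧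
      (∃ m : ℕ, d ≤ m ∧ ∀ n : ℕ, m ≤ n → BiclosingExtension.HasIrreducibleExtension φ n) := by
  have : Nonempty Y.carrier := ⟨hYirr.choose⟩
  obtain ⟨d, hd⟩ := hbc.exists_isGreatest hφ
  obtain ⟨l, hl, hld, hlφ⟩ := hbc.exists_label hφ fun y => hd.2 ⟨y, rfl⟩
  -- The strict entropy inequality acts only through the existence of a missed point.
  have hns : ¬ Function.Surjective φ := fun hs =>
    (BiclosingExtension.entropy_le_of_surjective hφ hs).not_gt hent
  have main : ∀ n : ℕ, d ≤ n → 0 < n → BiclosingExtension.HasIrreducibleExtension φ n :=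
    fun n hn hpos => BiclosingExtension.hasIrreducibleExtension_of_label hY hYirr hφ hns hpos
      (l := fun x => ⟨l x, (hld x).trans_le hn⟩)
      (continuous_discrete_rng.mpr fun i => by
        have : (fun x => (⟨l x, (hld x).trans_le hn⟩ : Fin n)) ⁻¹' {i} = l ⁻¹' {i.1} := by
          ext x
          simp [Fin.ext_iff]
        rw [this]
        exact (isOpen_discrete _).preimage hl)
      fun x x' h h' => hlφ x x' h (Fin.ext_iff.mp h')
  refine ⟨d, hd, fun ⟨x, hx⟩ _ _ n hn => ?_, fun _ n hn => main n (by omega) (by omega),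
    d + 1, by omega, fun n hn => main n (by omega) (by omega)⟩
  -- A point of `X` has a label below `d`, so `d`, and with it `n`, is positive.
  exact main n hn ((Nat.zero_le _).trans_lt ((hld ⟨x, hx⟩).trans_le hn))
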